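/- All graphs are finite, simple and undirected. A drawing of a graph $G$ represents the vertices by distinct points of $\mathbb{R}^2$ and each edge $uv$ by a simple curve with endpoints $u$ and $v$ that contains no other vertex. A crossing is a triple $(p,\{e,f\})$ where $e\neq f$ are edges and $p$ is a common point of the curves of $e$ and $f$ that is not an end of $e$ or of $f$. $G$ is $1$-gap planar if it has a drawing in which every crossing can be charged to one of its two edges so that at most one crossing is charged to each edge. Let $\mathrm{tw}(G)$ be the treewidth of $G$. The row treewidth of $G$ is the minimum treewidth of a graph $H$ such that $G$ is isomorphic to a subgraph of the strong product $H\boxtimes P$ for some path $P$. A class $\mathcal G$ of graphs has linear local treewidth if there is a linear function $f(r)=ar+b$ such that for every $G\in\mathcal G$, every vertex $v$ of $G$ and every integer $r\ge 0$, the subgraph of $G$ induced by the vertices at distance at most $r$ from $v$ has treewidth at most $f(r)$. Theorem. (1) For all integers $n,k\ge 1$ there is a $1$-gap planar graph with treewidth at least $n^{k+1}+1$ and radius at most $(2k+1)n+\lceil k/2\rceil+1$. (2) There is a constant $c>0$ such that for infinitely many integers $r\ge 1$ there is a $1$-gap planar graph $G$ with radius at most $r$ and $\mathrm{tw}(G)\ge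 2^{cr}$. (3) The class of $1$-gap planar graphs does not have linear local treewidth. (4) The class of $1$-gap planar graphs has unbounded row treewidth: for every integer $t$ there is a $1$-gap planar graph with row treewidth greater than $t$. -/

import Mathlib

/-- A tree-decomposition of a graph `G`, indexed by the nodes of a finite tree. -/
structure TreeDecomposition {V : Type*} (G : SimpleGraph V) where
  /-- the nodes of the tree -/
  Node : Type
  finite_node : Finite Node
  tree : SimpleGraph Node
  isTree : tree.IsTree
  bag : Node → Set V
  /-- the nodes whose bags contain a given vertex induce a nonempty subtree
  (`Connected` includes non-emptiness) -/
  connected_nodes : ∀ v : V, (tree.induce {x | v ∈ bag x}).Connected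
  /-- both ends of every edge lie in a common bag -/
  exists_bag : ∀ u v : V, G.Adj u v → ∃ x, u ∈ bag x ∧ v ∈ bag x

/-- Every bag has at most `w + 1` vertices. -/
def TreeDecomposition.WidthLE {V : Type*} {G : SimpleGraph V}
    (D : TreeDecomposition G) (w : ℕ) : Prop :=
  ∀ x, (D.bag x).encard ≤ (w : ℕ∞) + 1

/-- The treewidth of a finite graph: the least width of a tree-decomposition. -/
noncomputable def treewidth {V : Type*} (G : SimpleGraph V) : ℕ :=
  sInf {w : ℕ | ∃ D : TreeDecomposition G, D.WidthLE w}

/-- For finite graphs the infimum in `treewidth` is over a nonempty set. -/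
theorem exists_treeDecomposition_widthLE {V : Type*} [Finite V] (G : SimpleGraph V) :
    {w : ℕ | ∃ D : TreeDecomposition G, D.WidthLE w}.Nonempty := by
  refine ⟨Nat.card V, ⟨Unit, inferInstance, ⊥, SimpleGraph.IsTree.of_subsingleton,
    fun _ => Set.univ, ?_, ?_⟩, ?_⟩
  · intro v
    have : Nonempty {x : Unit | v ∈ (Set.univ : Set V)} := ⟨⟨(), trivial⟩⟩
    exact ⟨fun a b => by
      have hab : a = b := Subsingleton.elim a b
      subst hab
      exact SimpleGraph.Reachable.refl a⟩
  · intro u v _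
    exact ⟨(), trivial, trivial⟩
  · intro x
    change (Set.univ : Set V).encard ≤ _
    rw [Set.encard_univ, ENat.card_eq_coe_natCard]
    exact le_self_add

/-- A drawing of `G` in the plane: vertices are distinct points, and each edge is an arc (the image
of an injective path) that joins its two ends and meets no other vertex. -/
structure PlaneDrawing {V : Type*} (G : SimpleGraph V) where
  pos : V → ℝ × ℝ
  pos_injective : Function.Injective pos
  curve : G.edgeSet → Set (ℝ × ℝ)
  isArc : ∀ (e : G.edgeSet) (u v : V), (e : Sym2 V) = s(u, v) →
    ∃ γ : Path (pos u) (pos v), Function.Injective γ ∧ Set.range γ = curve e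
  mem_of_pos_mem : ∀ (e : G.edgeSet) (w : V), pos w ∈ curve e → w ∈ (e : Sym2 V)

/-- The crossings of a drawing: the pairs `(p, {e, f})` with `e ≠ f` edges and `p` a common point
of their curves that is not an end of `e` or of `f`. -/
def PlaneDrawing.crossings {V : Type*} {G : SimpleGraph V} (D : PlaneDrawing G) :
    Set ((ℝ × ℝ) × Sym2 G.edgeSet) :=
  {c | ∃ e f : G.edgeSet, e ≠ f ∧ c.2 = s(e, f) ∧ c.1 ∈ D.curve e ∩ D.curve f ∧
    ∀ v : V, v ∈ (e : Sym2 V) ∨ v ∈ (f : Sym2 V) → c.1 ≠ D.pos v}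

/-- Every crossing can be charged to one of its two edges so that at most `k` crossings are charged
to each edge. -/
def PlaneDrawing.IsGap {V : Type*} {G : SimpleGraph V} (D : PlaneDrawing G) (k : ℕ) : Prop :=
  ∃ charge : D.crossings → G.edgeSet,
    (∀ c : D.crossings, charge c ∈ c.1.2) ∧
    ∀ e : G.edgeSet, {c : D.crossings | charge c = e}.encard ≤ (k : ℕ∞)

/-- `G` is `k`-gap planar. -/
def IsGapPlanar (k : ℕ) {V : Type*} (G : SimpleGraph V) : Prop :=
  ∃ D : PlaneDrawing G, D.IsGap k

/-- The strong product of two graphs. -/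
def strongProduct {V W : Type*} (G : SimpleGraph V) (H : SimpleGraph W) :
    SimpleGraph (V × W) where
  Adj x y := (G.Adj x.1 y.1 ∧ (x.2 = y.2 ∨ H.Adj x.2 y.2)) ∨ (x.1 = y.1 ∧ H.Adj x.2 y.2)
  symm := ⟨by
    rintro x y (⟨h, h' | h'⟩ | ⟨h, h'⟩)
    · exact Or.inl ⟨h.symm, Or.inl h'.symm⟩
    · exact Or.inl ⟨h.symm, Or.inr h'.symm⟩
    · exact Or.inr ⟨h.symm, h'.symm⟩⟩
  loopless := ⟨by
    rintro x (⟨h, -⟩ | ⟨-, h⟩)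
    · exact G.irrefl h
    · exact H.irrefl h⟩

/-- The row treewidth of a finite graph `G`: the least treewidth of a finite graph `H` such that
`G` is isomorphic to a subgraph of the strong product of `H` and a path. -/
noncomputable def rowTreewidth {V : Type} (G : SimpleGraph V) : ℕ :=
  sInf {t : ℕ | ∃ (W : Type) (_ : Finite W) (H : SimpleGraph W) (m : ℕ),
    treewidth H = t ∧ G.IsContained (strongProduct H (SimpleGraph.pathGraph m))}

/-- For finite graphs the infimum in `rowTreewidth` is over a nonempty set. -/
theorem exists_isContained_strongProduct {V : Type} [Finite V] (G : SimpleGraph V) :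
    {t : ℕ | ∃ (W : Type) (_ : Finite W) (H : SimpleGraph W) (m : ℕ),
      treewidth H = t ∧
        G.IsContained (strongProduct H (SimpleGraph.pathGraph m))}.Nonempty :=
  ⟨treewidth G, V, inferInstance, G, 1, rfl,
    ⟨⟨⟨fun v => (v, 0), fun h => Or.inl ⟨h, Or.inl rfl⟩⟩,
      fun _ _ h => congrArg Prod.fst h⟩⟩⟩

/-- In every finite graph of the class `𝒢`, for every vertex `v` and every `r ≥ 0`, the subgraph
induced by the vertices at distance at most `r` from `v` has treewidth at most `f r`. -/
def LocalTreewidthLE (𝒢 : ∀ V : Type, SimpleGraph V → Prop) (f : ℕ → ℝ) : Prop :=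
  ∀ (V : Type) [Finite V] (G : SimpleGraph V), 𝒢 V G → ∀ (v : V) (r : ℕ),
    (treewidth (G.induce {w : V | G.edist v w ≤ (r : ℕ∞)}) : ℝ) ≤ f r

/-- The class `𝒢` has linear local treewidth. -/
def HasLinearLocalTreewidth (𝒢 : ∀ V : Type, SimpleGraph V → Prop) : Prop :=
  ∃ a b : ℝ, LocalTreewidthLE 𝒢 (fun r => a * r + b)

/-- The finite graphs of the class `𝒢` have bounded row treewidth. -/
def HasBoundedRowTreewidth (𝒢 : ∀ V : Type, SimpleGraph V → Prop) : Prop :=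
  ∃ t : ℕ, ∀ (V : Type) [Finite V] (G : SimpleGraph V), 𝒢 V G → rowTreewidth G ≤ t

/-! The witness is a grid whose rows have skip lengths `n ^ k, …, n, 1`, repeated periodically: row
`y` keeps only horizontal edges between consecutive multiples of its length `L y`, all vertical
edges remain, and an apex is joined to the first column.

Small radius: within one period, a column index is reached by reading its base-`n` expansion, one
digit per row, starting from the apex; this takes about `k * n` steps.

Large treewidth: the rows of length `1` are full paths. With as many of them as there are columns,
the row-column crosses are connected and pairwise intersecting, so by the Helly property of subtrees
some bag meets them all. That bag meets every row, or it misses a row and hence meets every column.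

Gap planarity: vertices of row `y` off the multiples of `L y` are raised by `1 / 2`, clear of the
horizontal edges. Each vertical edge is then crossed at most once, and every crossing involves a
vertical edge, to which it is charged.

Taking `n = 2` gives treewidth exponential in the radius, which rules out linear local treewidth. A
graph of radius `r` meets at most `2 * r + 1` layers of a product with a path, so bounded row
treewidth would make treewidth linear in the radius. -/

/-! ### Helly property of subtrees and a lower bound for treewidth -/

/-- Pairwise intersecting subtrees of a finite tree have a common node. -/
theorem SimpleGraph.IsTree.exists_mem_of_pairwise_inter {N ι : Type*} [Finite N] [Nonempty ι]
    {T : SimpleGraph N} (hT : T.IsTree) (S : ι → Set N)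
    (hS : ∀ i, (T.induce (S i)).Preconnected)
    (hinter : ∀ i j, (S i ∩ S j).Nonempty) : ∃ z, ∀ i, z ∈ S i := by
  classical
  have hfin := Fintype.ofFinite N
  obtain ⟨r⟩ := hT.connected.nonempty
  have hne : ∀ i, (S i).Nonempty := fun i => (hinter i i).mono Set.inter_subset_left
  choose m hm hmin using fun i =>
    Set.exists_min_image (S i) (T.dist r) (Set.toFinite _) (hne i)
  -- Root the tree at `r`. Among the subtrees choose one whose topmost node is deepest; that node
  -- lies in all of them.
  obtain ⟨i₀, hi₀⟩ : ∃ i₀, ∀ i, T.dist r (m i) ≤ T.dist r (m i₀) := by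
    obtain ⟨_, ⟨i₀, rfl⟩, h⟩ :=
      Set.exists_max_image (Set.range m) (T.dist r) (Set.toFinite _) (Set.range_nonempty m)
    exact ⟨i₀, fun i => h _ ⟨i, rfl⟩⟩
  refine ⟨m i₀, fun i => ?_⟩
  by_contra hnot
  set t := m i₀
  have hrt : t ≠ r := by
    intro h
    have h1 := hi₀ i
    rw [h, SimpleGraph.dist_self] at h1
    have h2 : r = m i := (hT.connected.dist_eq_zero_iff).1 (Nat.le_zero.1 h1)
    exact hnot (h ▸ h2 ▸ hm i)
  have hparent : ∀ v, v ≠ r → ∃ p, T.Adj p v ∧ T.dist r p + 1 = T.dist r v := by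
    intro v hv
    obtain ⟨w, hw⟩ := hT.connected.exists_walk_length_eq_dist v r
    cases w with
    | nil => exact absurd rfl hv
    | @cons _ p _ h q =>
      refine ⟨p, h.symm, ?_⟩
      have h1 : T.dist r p ≤ q.length := by
        rw [SimpleGraph.dist_comm]; exact SimpleGraph.dist_le q
      have h2 : T.dist r v ≤ T.dist r p + T.dist p v := hT.connected.dist_triangle
      have h3 : T.dist p v = 1 := SimpleGraph.dist_eq_one_iff_adj.2 h.symm
      rw [SimpleGraph.Walk.length_cons, SimpleGraph.dist_comm] at hw
      omega
  obtain ⟨p, hpt, hpd⟩ := hparent t hrt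
  -- Cut the edge from `t` to its parent `p`. A subtree that misses `t` or `p` stays connected, so a
  -- subtree missing `t` would link both sides of the cut.
  set T' := T.deleteEdges {s(p, t)} with hT'
  have hadj : ∀ a b, T.Adj a b → (a ≠ t ∧ b ≠ t ∨ a ≠ p ∧ b ≠ p) → T'.Adj a b := by
    intro a b hab h
    rw [hT', SimpleGraph.deleteEdges_adj]
    refine ⟨hab, ?_⟩
    rw [Set.mem_singleton_iff, Sym2.eq_iff]
    tauto
  have hset : ∀ j, (t ∉ S j ∨ p ∉ S j) → ∀ a ∈ S j, ∀ b ∈ S j, T'.Reachable a b := by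
    intro j hj a ha b hb
    refine (hS j ⟨a, ha⟩ ⟨b, hb⟩).map (⟨Subtype.val, ?_⟩ : T.induce (S j) →g T')
    rintro ⟨x, hx⟩ ⟨y, hy⟩ hxy
    refine hadj x y hxy ?_
    rcases hj with hj | hj
    · exact Or.inl ⟨fun h => hj (h ▸ hx), fun h => hj (h ▸ hy)⟩
    · exact Or.inr ⟨fun h => hj (h ▸ hx), fun h => hj (h ▸ hy)⟩
  -- Proper ancestors of a node no deeper than `t` are strictly less deep than `t`, so the path to
  -- the root avoids `t`.
  have hball : ∀ d, d ≤ T.dist r t → ∀ v, T.dist r v = d → v ≠ t → T'.Reachable r v := by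
    intro d
    induction d with
    | zero =>
      intro _ v hv _
      rw [(hT.connected.dist_eq_zero_iff).1 hv]
    | succ d ih =>
      intro hd v hv hvt
      have hvr : v ≠ r := by
        rintro rfl
        simp at hv
      obtain ⟨q, hq, hqd⟩ := hparent v hvr
      have hqt : q ≠ t := by
        rintro rfl
        omega
      exact (ih (by omega) q (by omega) hqt).trans (hadj q v hq (Or.inl ⟨hqt, hvt⟩)).reachable
  have hp : p ∉ S i₀ := fun h => by
    have : T.dist r t ≤ T.dist r p := hmin i₀ p h
    omega
  obtain ⟨u, hu, hu₀⟩ := hinter i i₀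
  have h1 : T'.Reachable r p := hball _ (by omega) p rfl hpt.ne
  have h2 : T'.Reachable r (m i) := hball _ (hi₀ i) (m i) rfl fun h => hnot (h ▸ hm i)
  have h3 : T'.Reachable (m i) u := hset i (Or.inl hnot) _ (hm i) _ hu
  have h4 : T'.Reachable u t := hset i₀ (Or.inr hp) _ hu₀ _ (hm i₀)
  have hb := SimpleGraph.isAcyclic_iff_forall_adj_isBridge.1 hT.isAcyclic hpt
  rw [SimpleGraph.isBridge_iff] at hb
  exact hb (((h1.symm.trans h2).trans h3).trans h4)

namespace TreeDecomposition

variable {V : Type*} {G : SimpleGraph V}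

/-- The nodes whose bags meet a connected set of vertices form a subtree. -/
theorem preconnected_meeting (D : TreeDecomposition G) (X : Set V)
    (hX : (G.induce X).Preconnected) :
    (D.tree.induce {z | ∃ v ∈ X, v ∈ D.bag z}).Preconnected := by
  set S : Set D.Node := {z | ∃ v ∈ X, v ∈ D.bag z} with hS
  have hone : ∀ v (hv : v ∈ X) a (ha : v ∈ D.bag a) b (hb : v ∈ D.bag b),
      (D.tree.induce S).Reachable ⟨a, v, hv, ha⟩ ⟨b, v, hv, hb⟩ := by
    intro v hv a ha b hb
    exact ((D.connected_nodes v).preconnected ⟨a, ha⟩ ⟨b, hb⟩).map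
      (⟨fun z => ⟨z.1, v, hv, z.2⟩, fun h => h⟩ :
        D.tree.induce {x | v ∈ D.bag x} →g D.tree.induce S)
  -- Consecutive vertices of a walk share a bag, so their subtrees overlap and can be chained.
  have hwalk : ∀ (v w : X), (G.induce X).Walk v w → ∀ a (ha : v.1 ∈ D.bag a) b
      (hb : w.1 ∈ D.bag b), (D.tree.induce S).Reachable ⟨a, v.1, v.2, ha⟩ ⟨b, w.1, w.2, hb⟩ := by
    intro v w q
    induction q with
    | @nil v => intro a ha b hb; exact hone _ v.2 a ha b hb
    | @cons v v' w h q ih =>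
      intro a ha b hb
      obtain ⟨c, hc, hc'⟩ := D.exists_bag v.1 v'.1 h
      exact (hone _ v.2 a ha c hc).trans (ih c hc' b hb)
  rintro ⟨a, v, hv, ha⟩ ⟨b, w, hw, hb⟩
  obtain ⟨q⟩ := hX ⟨v, hv⟩ ⟨w, hw⟩
  exact hwalk _ _ q a ha b hb

/-- Some bag meets every member of a family of pairwise intersecting connected sets. -/
theorem exists_bag_meeting {ι : Type*} [Nonempty ι] (D : TreeDecomposition G) (X : ι → Set V)
    (hX : ∀ i, (G.induce (X i)).Preconnected) (hinter : ∀ i j, (X i ∩ X j).Nonempty) :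
    ∃ z, ∀ i, ∃ v ∈ X i, v ∈ D.bag z := by
  have := D.finite_node
  refine D.isTree.exists_mem_of_pairwise_inter (fun i => {z | ∃ v ∈ X i, v ∈ D.bag z})
    (fun i => D.preconnected_meeting (X i) (hX i)) fun i j => ?_
  obtain ⟨v, hi, hj⟩ := hinter i j
  obtain ⟨z, hz⟩ := (D.connected_nodes v).nonempty
  exact ⟨z, ⟨v, hi, hz⟩, v, hj, hz⟩

end TreeDecomposition

theorem exists_treeDecomposition_widthLE_treewidth {V : Type*} [Finite V] (G : SimpleGraph V) :
    ∃ D : TreeDecomposition G, D.WidthLE (treewidth G) :=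
  Nat.sInf_mem (exists_treeDecomposition_widthLE G)

theorem treewidth_le_of_widthLE {V : Type*} {G : SimpleGraph V} (D : TreeDecomposition G) {w : ℕ}
    (h : D.WidthLE w) : treewidth G ≤ w :=
  Nat.sInf_le ⟨D, h⟩

/-- If `m` disjoint sets (rows) and `m` disjoint sets (columns) are such that the union of each row
with each column is connected and each row meets each column, then the treewidth is at least
`m - 1`. -/
theorem le_treewidth_add_one_of_crosses {V : Type*} [Finite V] {G : SimpleGraph V} {m : ℕ}
    (hm : 0 < m) (R C : Fin m → Set V)
    (hR : Pairwise fun i j => Disjoint (R i) (R j)) (hC : Pairwise fun i j => Disjoint (C i) (C j))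
    (hconn : ∀ i j, (G.induce (R i ∪ C j)).Preconnected)
    (hmeet : ∀ i j, (R i ∩ C j).Nonempty) : m ≤ treewidth G + 1 := by
  obtain ⟨D, hD⟩ := exists_treeDecomposition_widthLE_treewidth G
  have : Nonempty (Fin m × Fin m) := ⟨⟨0, hm⟩, ⟨0, hm⟩⟩
  -- Two crosses intersect because the row of one meets the column of the other.
  obtain ⟨z, hz⟩ := D.exists_bag_meeting (fun ij : Fin m × Fin m => R ij.1 ∪ C ij.2)
    (fun ij => hconn _ _) fun ij kl =>
      (hmeet ij.1 kl.2).mono fun v hv => ⟨Or.inl hv.1, Or.inr hv.2⟩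
  have key : ∀ A : Fin m → Set V, (Pairwise fun i j => Disjoint (A i) (A j)) →
      (∀ i, ∃ v ∈ A i, v ∈ D.bag z) → m ≤ treewidth G + 1 := by
    intro A hA h
    choose f hf hfz using h
    have hinj : Function.Injective f := by
      intro i j hij
      by_contra hne
      exact Set.disjoint_left.1 (hA hne) (hf i) (hij ▸ hf j)
    have h1 : (Set.range f).encard ≤ (D.bag z).encard :=
      Set.encard_le_encard (Set.range_subset_iff.2 hfz)
    have h2 : (Set.range f).encard = m := by
      rw [← Set.image_univ, hinj.encard_image, Set.encard_univ]
      simp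
    have h3 := h1.trans (hD z)
    rw [h2] at h3
    exact_mod_cast h3
  -- If the bag misses row `i`, it must meet the crosses of row `i` in their columns, hence it meets
  -- every column.
  by_cases hall : ∀ i, ∃ v ∈ R i, v ∈ D.bag z
  · exact key R hR hall
  · push Not at hall
    obtain ⟨i, hi⟩ := hall
    refine key C hC fun j => ?_
    obtain ⟨v, hv | hv, hvz⟩ := hz (i, j)
    · exact absurd hvz (hi v hv)
    · exact ⟨v, hv, hvz⟩

/-! ### Treewidth in terms of row treewidth and radius -/

/-- Treewidth of a graph mapped injectively to a product of a graph with `s` points, such that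
adjacent vertices have equal or adjacent first coordinates. -/
theorem treewidth_le_of_layered {V W : Type*} [Finite W] {G : SimpleGraph V} {H : SimpleGraph W}
    (f : V → W) (g : V → ℕ) (s : Finset ℕ) (hinj : ∀ u v, f u = f v → g u = g v → u = v)
    (hg : ∀ v, g v ∈ s) (hadj : ∀ u v, G.Adj u v → f u = f v ∨ H.Adj (f u) (f v)) :
    treewidth G ≤ (treewidth H + 1) * s.card := by
  obtain ⟨D, hD⟩ := exists_treeDecomposition_widthLE_treewidth H
  refine treewidth_le_of_widthLE
    { Node := D.Node
      finite_node := D.finite_node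
      tree := D.tree
      isTree := D.isTree
      bag := fun z => {v | f v ∈ D.bag z}
      connected_nodes := fun v => D.connected_nodes (f v)
      exists_bag := ?_ } ?_
  · intro u v huv
    rcases hadj u v huv with h | h
    · obtain ⟨z, hz⟩ := (D.connected_nodes (f u)).nonempty
      exact ⟨z, hz, by simpa [← h] using hz⟩
    · exact D.exists_bag _ _ h
  · intro z
    change ({v | f v ∈ D.bag z} : Set V).encard ≤ _
    have h1 : ({v | f v ∈ D.bag z} : Set V).encard ≤ (D.bag z ×ˢ (s : Set ℕ)).encard :=
      Set.encard_le_encard_of_injOn (f := fun v => (f v, g v)) (fun v hv => ⟨hv, hg v⟩)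
        fun u _ v _ h => hinj u v (congrArg Prod.fst h) (congrArg Prod.snd h)
    refine h1.trans ?_
    rw [Set.encard_prod, Set.encard_coe_eq_coe_finsetCard]
    calc (D.bag z).encard * (s.card : ℕ∞) ≤ ((treewidth H : ℕ∞) + 1) * s.card := by
          gcongr
          exact hD z
      _ ≤ _ := by
          push_cast
          exact le_self_add

/-- Passes from a graph to the ball around its centre when the ball is the whole graph. -/
theorem treewidth_le_treewidth_induce_of_forall_mem {V : Type*} [Finite V] (G : SimpleGraph V)
    {s : Set V} (hs : ∀ v, v ∈ s) : treewidth G ≤ treewidth (G.induce s) := by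
  obtain ⟨D, hD⟩ := exists_treeDecomposition_widthLE_treewidth (G.induce s)
  refine treewidth_le_of_widthLE
    { Node := D.Node
      finite_node := D.finite_node
      tree := D.tree
      isTree := D.isTree
      bag := fun z => Subtype.val '' D.bag z
      connected_nodes := ?_
      exists_bag := ?_ } ?_
  · intro v
    have h : {z | v ∈ Subtype.val '' D.bag z} = {z | (⟨v, hs v⟩ : s) ∈ D.bag z} := by
      ext z
      simp [hs v]
    rw [h]
    exact D.connected_nodes _
  · intro u v huv
    obtain ⟨z, hu, hv⟩ := D.exists_bag ⟨u, hs u⟩ ⟨v, hs v⟩ huv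
    exact ⟨z, ⟨_, hu, rfl⟩, _, hv, rfl⟩
  · intro z
    exact (Set.encard_image_le _ _).trans (hD z)

/-- A graph of radius `r` and row treewidth `t` has treewidth at most `(t + 1) (2 r + 1)`. -/
theorem treewidth_le_of_edist_le {V : Type} [Finite V] (G : SimpleGraph V) (c : V) (r : ℕ)
    (hr : ∀ v, G.edist c v ≤ r) : treewidth G ≤ (rowTreewidth G + 1) * (2 * r + 1) := by
  obtain ⟨W, _, H, m, hH, ⟨φ⟩⟩ := Nat.sInf_mem (exists_isContained_strongProduct G)
  change treewidth H = rowTreewidth G at hH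
  rw [← hH]
  -- An edge of the product changes the path coordinate by at most one.
  have hwalk : ∀ u v (q : G.Walk u v),
      (φ v).2.val ≤ (φ u).2.val + q.length ∧ (φ u).2.val ≤ (φ v).2.val + q.length := by
    intro u v q
    induction q with
    | nil => simp
    | @cons u w v h q ih =>
      rw [SimpleGraph.Walk.length_cons]
      have h1 : (φ u).2 = (φ w).2 ∨ (SimpleGraph.pathGraph m).Adj (φ u).2 (φ w).2 := by
        rcases φ.toHom.map_rel h with h | h
        · exact h.2
        · exact Or.inr h.2
      rw [SimpleGraph.pathGraph_adj] at h1
      rcases h1 with h1 | h1 | h1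
      · rw [h1]; omega
      · omega
      · omega
  have hdist : ∀ v, (φ v).2.val ≤ (φ c).2.val + r ∧ (φ c).2.val ≤ (φ v).2.val + r := by
    intro v
    have h1 : G.edist c v ≠ ⊤ := fun h => by
      have := hr v
      rw [h] at this
      exact absurd this (by simp)
    obtain ⟨q, hq⟩ := SimpleGraph.exists_walk_of_edist_ne_top h1
    have h2 : q.length ≤ r := by
      have := hr v
      rw [← hq] at this
      exact_mod_cast this
    have := hwalk c v q
    omega
  -- Only layers within `r` of the centre's layer occur; truncated subtraction can only shorten this
  -- interval of at most `2 * r + 1` values.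
  refine (treewidth_le_of_layered (H := H) (fun v => (φ v).1) (fun v => (φ v).2.val)
    (Finset.Icc ((φ c).2.val - r) ((φ c).2.val + r)) ?_ ?_ ?_).trans ?_
  · intro u v h1 h2
    exact φ.injective (Prod.ext h1 (Fin.ext h2))
  · intro v
    have := hdist v
    rw [Finset.mem_Icc]
    omega
  · intro u v huv
    rcases φ.toHom.map_rel huv with h | h
    · exact Or.inr h.1
    · exact Or.inl h.1
  · rw [Nat.card_Icc]
    exact Nat.mul_le_mul_left _ (by omega)

/-! ### Straight-line drawings and a criterion for gap planarity -/

/-- The straight-line drawing determined by the positions of the vertices. -/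
def PlaneDrawing.straightLine {V : Type*} (G : SimpleGraph V) (pos : V → ℝ × ℝ)
    (hinj : Function.Injective pos)
    (hmem : ∀ u v w, G.Adj u v → pos w ∈ segment ℝ (pos u) (pos v) → w = u ∨ w = v) :
    PlaneDrawing G where
  pos := pos
  pos_injective := hinj
  curve e := Sym2.lift ⟨fun u v => segment ℝ (pos u) (pos v), fun _ _ => segment_symm _ _ _⟩ e.1
  isArc := by
    rintro ⟨e, he⟩ u v (rfl : e = _)
    have hne : pos u ≠ pos v := hinj.ne (G.ne_of_adj he)
    refine ⟨⟨⟨fun t => AffineMap.lineMap (pos u) (pos v) (t : ℝ), ?_⟩, ?_, ?_⟩, ?_, ?_⟩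
    · exact AffineMap.lineMap_continuous.comp continuous_subtype_val
    · simp
    · simp
    · intro s t hst
      exact Subtype.ext (AffineMap.lineMap_injective ℝ hne hst)
    · change _ = segment ℝ (pos u) (pos v)
      rw [segment_eq_image_lineMap]
      ext p
      constructor
      · rintro ⟨t, rfl⟩
        exact ⟨t, t.2, rfl⟩
      · rintro ⟨t, ht, rfl⟩
        exact ⟨⟨t, ht⟩, rfl⟩
  mem_of_pos_mem := by
    rintro ⟨e, he⟩ w
    induction e with
    | _ u v =>
      intro hw
      exact Sym2.mem_iff.2 (hmem u v w he hw)

/-- If the crossings can be charged to edges of a certain kind, each of which takes part in at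
most one crossing, then the drawing is a `1`-gap drawing. -/
theorem PlaneDrawing.isGap_one {V : Type*} {G : SimpleGraph V} (D : PlaneDrawing G)
    (P : G.edgeSet → Prop) (hex : ∀ c ∈ D.crossings, ∃ e ∈ c.2, P e)
    (huniq : ∀ c ∈ D.crossings, ∀ c' ∈ D.crossings, ∀ e, P e → e ∈ c.2 → e ∈ c'.2 → c = c') :
    D.IsGap 1 := by
  choose f hf hfP using fun c : D.crossings => hex c.1 c.2
  refine ⟨f, hf, fun e => ?_⟩
  rw [Nat.cast_one, Set.encard_le_one_iff]
  rintro c c' rfl hc'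
  exact Subtype.ext (huniq _ c.2 _ c'.2 (f c) (hfP c) (hf c) (hc' ▸ hf c'))

/-! ### The skip grid and its drawing -/

/-- The grid with `a` columns and `b` rows in which the horizontal edges of row `y` are replaced by
edges of length `L y` between multiples of `L y`, together with an apex vertex adjacent to the
first column. -/
def skipGrid (L : ℕ → ℕ) (a b : ℕ) : SimpleGraph (Option (Fin a × Fin b)) :=
  SimpleGraph.fromRel fun u v =>
    (u = none ∧ ∃ q, v = some q ∧ q.1.val = 0) ∨
    (∃ p q, u = some p ∧ v = some q ∧ q.1.val = p.1.val ∧ q.2.val = p.2.val + 1) ∨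
    (∃ p q, u = some p ∧ v = some q ∧ q.2.val = p.2.val ∧ L p.2.val ∣ p.1.val ∧
      q.1.val = p.1.val + L p.2.val)

namespace skipGrid

variable {L : ℕ → ℕ} {a b : ℕ}

theorem adj_apex {q : Fin a × Fin b} (h : q.1.val = 0) : (skipGrid L a b).Adj none (some q) :=
  ⟨by simp, Or.inl (Or.inl ⟨rfl, q, rfl, h⟩)⟩

theorem adj_vertical {p q : Fin a × Fin b} (h₁ : q.1.val = p.1.val)
    (h₂ : q.2.val = p.2.val + 1) : (skipGrid L a b).Adj (some p) (some q) := by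
  refine ⟨?_, Or.inl (Or.inr (Or.inl ⟨p, q, rfl, rfl, h₁, h₂⟩))⟩
  rintro h
  rw [Option.some.inj h] at h₂
  omega

theorem adj_horizontal {p q : Fin a × Fin b} (hL : 0 < L p.2.val) (h₁ : q.2.val = p.2.val)
    (h₂ : L p.2.val ∣ p.1.val) (h₃ : q.1.val = p.1.val + L p.2.val) :
    (skipGrid L a b).Adj (some p) (some q) := by
  refine ⟨?_, Or.inl (Or.inr (Or.inr ⟨p, q, rfl, rfl, h₁, h₂, h₃⟩))⟩
  rintro h
  rw [← Option.some.inj h] at h₃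
  omega

/-- The vertical edges. -/
def IsVertical {a b : ℕ} (e : Sym2 (Option (Fin a × Fin b))) : Prop :=
  ∃ p q : Fin a × Fin b, e = s(some p, some q) ∧ q.1.val = p.1.val ∧ q.2.val = p.2.val + 1

/-- The horizontal edges. -/
def IsHorizontal (L : ℕ → ℕ) {a b : ℕ} (e : Sym2 (Option (Fin a × Fin b))) : Prop :=
  ∃ p q : Fin a × Fin b, e = s(some p, some q) ∧ q.2.val = p.2.val ∧ L p.2.val ∣ p.1.val ∧
    q.1.val = p.1.val + L p.2.val

/-- The edges at the apex. -/
def IsRadial {a b : ℕ} (e : Sym2 (Option (Fin a × Fin b))) : Prop :=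
  ∃ q : Fin a × Fin b, e = s(none, some q) ∧ q.1.val = 0

theorem edge_cases {e : Sym2 (Option (Fin a × Fin b))} (he : e ∈ (skipGrid L a b).edgeSet) :
    IsRadial e ∨ IsVertical e ∨ IsHorizontal L e := by
  induction e with
  | _ u v =>
    have key : ∀ u v : Option (Fin a × Fin b), ((u = none ∧ ∃ q, v = some q ∧ q.1.val = 0) ∨
        (∃ p q, u = some p ∧ v = some q ∧ q.1.val = p.1.val ∧ q.2.val = p.2.val + 1) ∨
        (∃ p q, u = some p ∧ v = some q ∧ q.2.val = p.2.val ∧ L p.2.val ∣ p.1.val ∧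
          q.1.val = p.1.val + L p.2.val)) →
        IsRadial s(u, v) ∨ IsVertical s(u, v) ∨ IsHorizontal L s(u, v) := by
      rintro u v (⟨rfl, q, rfl, h⟩ | ⟨p, q, rfl, rfl, h⟩ | ⟨p, q, rfl, rfl, h⟩)
      · exact Or.inl ⟨q, rfl, h⟩
      · exact Or.inr (Or.inl ⟨p, q, rfl, h⟩)
      · exact Or.inr (Or.inr ⟨p, q, rfl, h⟩)
    rcases he.2 with h | h
    · exact key u v h
    · rw [Sym2.eq_swap]
      exact key v u h

/-- The height at which vertex `(x, y)` is drawn. -/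
noncomputable def height (L : ℕ → ℕ) (x y : ℕ) : ℝ :=
  -- The shift `1 / 2` takes a vertex off the integer height of its row's horizontal edges, and
  -- being less than `1` it preserves the order within a column.
  y + if L y ∣ x then 0 else 1 / 2

theorem height_of_dvd {x y : ℕ} (h : L y ∣ x) : height L x y = y := by
  simp [height, h]

theorem height_of_not_dvd {x y : ℕ} (h : ¬ L y ∣ x) : height L x y = y + 1 / 2 := by
  simp [height, h]

theorem le_height (x y : ℕ) : (y : ℝ) ≤ height L x y := by
  unfold height
  split_ifs <;> linarith

theorem height_le (x y : ℕ) : height L x y ≤ y + 1 / 2 := by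
  unfold height
  split_ifs <;> linarith

theorem height_strictMono (x : ℕ) : StrictMono (height L x) := by
  refine strictMono_nat_of_lt_succ fun y => ?_
  have h₁ := height_le (L := L) x y
  have h₂ := le_height (L := L) x (y + 1)
  push_cast at h₂
  linarith

theorem height_eq_natCast_iff {x y z : ℕ} : height L x y = z ↔ y = z ∧ L y ∣ x := by
  constructor
  · intro h
    by_cases hd : L y ∣ x
    · rw [height_of_dvd hd] at h
      exact ⟨by exact_mod_cast h, hd⟩
    · rw [height_of_not_dvd hd] at h
      have h₁ : y < z := by
        have : (y : ℝ) < z := by linarith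
        exact_mod_cast this
      have h₂ : z < y + 1 := by
        have : (z : ℝ) < y + 1 := by linarith
        exact_mod_cast this
      omega
  · rintro ⟨rfl, h⟩
    exact height_of_dvd h

/-- The position at which a vertex is drawn. -/
noncomputable def pos (L : ℕ → ℕ) {a b : ℕ} : Option (Fin a × Fin b) → ℝ × ℝ
  | none => (-1, 0)
  | some p => (p.1.val, height L p.1.val p.2.val)

theorem pos_none : pos L (none : Option (Fin a × Fin b)) = (-1, 0) := rfl

theorem pos_some (p : Fin a × Fin b) :
    pos L (some p) = ((p.1.val : ℝ), height L p.1.val p.2.val) := rfl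

theorem pos_injective : Function.Injective (pos L : Option (Fin a × Fin b) → ℝ × ℝ) := by
  rintro (_ | ⟨x, y⟩) (_ | ⟨x', y'⟩) h
  · rfl
  · have h₁ : (-1 : ℝ) = x'.val := congrArg Prod.fst h
    have := Nat.cast_nonneg (α := ℝ) x'.val
    linarith
  · have h₁ : (x.val : ℝ) = -1 := congrArg Prod.fst h
    have := Nat.cast_nonneg (α := ℝ) x.val
    linarith
  · have h₁ : (x.val : ℝ) = x'.val := congrArg Prod.fst h
    have h₂ : height L x.val y.val = height L x'.val y'.val := congrArg Prod.snd h
    have hx : x = x' := Fin.ext (by exact_mod_cast h₁)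
    subst hx
    rw [Fin.ext ((height_strictMono x.val).injective h₂)]

/-- The segment that represents an edge. -/
noncomputable def curve (L : ℕ → ℕ) {a b : ℕ} (e : Sym2 (Option (Fin a × Fin b))) : Set (ℝ × ℝ) :=
  Sym2.lift ⟨fun u v => segment ℝ (pos L u) (pos L v), fun _ _ => segment_symm _ _ _⟩ e

theorem mem_segment_coords {u v p : ℝ × ℝ} (hp : p ∈ segment ℝ u v) :
    ∃ t : ℝ, 0 ≤ t ∧ t ≤ 1 ∧ p.1 = u.1 + t * (v.1 - u.1) ∧ p.2 = u.2 + t * (v.2 - u.2) := by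
  rw [segment_eq_image_lineMap] at hp
  obtain ⟨t, ht, rfl⟩ := hp
  refine ⟨t, ht.1, ht.2, ?_, ?_⟩
  · simp [AffineMap.lineMap_apply]; ring
  · simp [AffineMap.lineMap_apply]; ring

/-- The first column is never lifted, as `0` is a multiple of everything, so a radial edge runs from
`(-1, 0)` to `(0, q.2)`. -/
theorem mem_radial {q : Fin a × Fin b} (hq : q.1.val = 0) {p : ℝ × ℝ}
    (hp : p ∈ curve L s(none, some q)) : p.1 ≤ 0 ∧ p.2 = (p.1 + 1) * q.2.val := by
  obtain ⟨t, h₀, h₁, h₂, h₃⟩ := mem_segment_coords hp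
  simp only [pos_none, pos_some, hq, height_of_dvd (dvd_zero _)] at h₂ h₃
  push_cast at h₂
  refine ⟨by linarith, ?_⟩
  rw [h₃, h₂]
  ring

theorem mem_vertical {r q : Fin a × Fin b} (h₁ : q.1.val = r.1.val)
    (h₂ : q.2.val = r.2.val + 1) {p : ℝ × ℝ} (hp : p ∈ curve L s(some r, some q)) :
    p.1 = r.1.val ∧ height L r.1.val r.2.val ≤ p.2 ∧ p.2 ≤ height L r.1.val (r.2.val + 1) := by
  obtain ⟨t, ht₀, ht₁, ht₂, ht₃⟩ := mem_segment_coords hp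
  simp only [pos_some, h₁, h₂] at ht₂ ht₃
  have h := (height_strictMono (L := L) r.1.val) (Nat.lt_succ_self r.2.val)
  refine ⟨by rw [ht₂]; ring, ?_, ?_⟩ <;> rw [ht₃] <;> nlinarith

theorem mem_horizontal {r q : Fin a × Fin b} (h₁ : q.2.val = r.2.val) (h₂ : L r.2.val ∣ r.1.val)
    (h₃ : q.1.val = r.1.val + L r.2.val) {p : ℝ × ℝ} (hp : p ∈ curve L s(some r, some q)) :
    p.2 = r.2.val ∧ (r.1.val : ℝ) ≤ p.1 ∧ p.1 ≤ r.1.val + L r.2.val := by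
  obtain ⟨t, ht₀, ht₁, ht₂, ht₃⟩ := mem_segment_coords hp
  have h₄ : L r.2.val ∣ r.1.val + L r.2.val := dvd_add h₂ dvd_rfl
  simp only [pos_some, h₁, h₃, height_of_dvd h₂, height_of_dvd h₄] at ht₂ ht₃
  push_cast at ht₂
  have := Nat.cast_nonneg (α := ℝ) (L r.2.val)
  refine ⟨by rw [ht₃]; ring, ?_, ?_⟩ <;> rw [ht₂] <;> nlinarith

/-- Radial edges stay in `x ≤ 0`, where only the apex and the first column lie. A vertical edge
joins consecutive points of a column. A horizontal edge has integer height, where only multiples of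
`L y` are drawn, and it joins consecutive multiples. -/
theorem mem_of_pos_mem_curve {e : Sym2 (Option (Fin a × Fin b))}
    (he : e ∈ (skipGrid L a b).edgeSet) {w : Option (Fin a × Fin b)} (hw : pos L w ∈ curve L e) :
    w ∈ e := by
  rcases edge_cases he with ⟨q, rfl, h⟩ | ⟨p, q, rfl, h₁, h₂⟩ | ⟨p, q, rfl, h₁, h₂, h₃⟩ <;>
    rw [Sym2.mem_iff]
  · obtain ⟨hw₁, hw₂⟩ := mem_radial h hw
    rcases w with _ | ⟨x, y⟩
    · exact Or.inl rfl
    · right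
      simp only [pos_some] at hw₁ hw₂
      have hx : x.val = 0 := by
        have : x.val ≤ 0 := by exact_mod_cast hw₁
        omega
      rw [hx, height_of_dvd (dvd_zero _)] at hw₂
      have hy : y.val = q.2.val := by
        have : (y.val : ℝ) = q.2.val := by rw [hw₂]; push_cast; ring
        exact_mod_cast this
      exact congrArg some (Prod.ext (Fin.ext (hx.trans h.symm)) (Fin.ext hy))
  · obtain ⟨hw₁, hw₂, hw₃⟩ := mem_vertical h₁ h₂ hw
    rcases w with _ | ⟨x, y⟩
    · simp only [pos_none] at hw₁
      have := Nat.cast_nonneg (α := ℝ) p.1.val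
      linarith
    · simp only [pos_some] at hw₁ hw₂ hw₃
      have hx : x.val = p.1.val := by exact_mod_cast hw₁
      rw [hx, (height_strictMono _).le_iff_le] at hw₂ hw₃
      rcases Nat.lt_or_ge p.2.val y.val with hlt | hge
      · exact Or.inr (congrArg some
          (Prod.ext (Fin.ext (hx.trans h₁.symm)) (Fin.ext (by simp only; omega))))
      · exact Or.inl (congrArg some (Prod.ext (Fin.ext hx) (Fin.ext (by simp only; omega))))
  · obtain ⟨hw₁, hw₂, hw₃⟩ := mem_horizontal h₁ h₂ h₃ hw
    rcases w with _ | ⟨x, y⟩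
    · simp only [pos_none] at hw₂
      have := Nat.cast_nonneg (α := ℝ) p.1.val
      linarith
    · simp only [pos_some] at hw₁ hw₂ hw₃
      obtain ⟨hy, hd⟩ := height_eq_natCast_iff.1 hw₁
      have hx₁ : p.1.val ≤ x.val := by exact_mod_cast hw₂
      have hx₂ : x.val ≤ p.1.val + L p.2.val := by exact_mod_cast hw₃
      rw [hy] at hd
      obtain ⟨i, hi⟩ := h₂
      obtain ⟨j, hj⟩ := hd
      have hx : x.val = p.1.val ∨ x.val = p.1.val + L p.2.val := by
        rcases Nat.eq_zero_or_pos (L p.2.val) with h0 | h0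
        · omega
        · have hij : i ≤ j := by
            rw [hi, hj] at hx₁
            exact Nat.le_of_mul_le_mul_left hx₁ h0
          have hji : j ≤ i + 1 := by
            rw [hi, hj, ← Nat.mul_succ] at hx₂
            exact Nat.le_of_mul_le_mul_left hx₂ h0
          rcases Nat.lt_or_ge i j with hlt | hge
          · right
            rw [hj, hi, show j = i + 1 by omega, Nat.mul_succ]
          · left
            rw [hj, hi, show j = i by omega]
      rcases hx with hx | hx
      · exact Or.inl (congrArg some (Prod.ext (Fin.ext hx) (Fin.ext hy)))
      · exact Or.inr (congrArg some
          (Prod.ext (Fin.ext (hx.trans h₃.symm)) (Fin.ext (hy.trans h₁.symm))))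

/-- The straight-line drawing of `skipGrid L a b`. -/
noncomputable def drawing (L : ℕ → ℕ) (a b : ℕ) : PlaneDrawing (skipGrid L a b) :=
  PlaneDrawing.straightLine _ (pos L) pos_injective fun _ _ _ h hw =>
    Sym2.mem_iff.1 (mem_of_pos_mem_curve ((SimpleGraph.mem_edgeSet _).2 h) hw)

end skipGrid

/-! ### Crossings of the drawing -/

namespace skipGrid

variable {L : ℕ → ℕ} {a b : ℕ}

theorem radial_inter_radial {q q' : Fin a × Fin b} (hq : q.1.val = 0) (hq' : q'.1.val = 0)
    (hne : q ≠ q') {p : ℝ × ℝ} (hp : p ∈ curve L s(none, some q))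
    (hp' : p ∈ curve L s(none, some q')) : p = pos L (none : Option (Fin a × Fin b)) := by
  obtain ⟨-, h⟩ := mem_radial hq hp
  obtain ⟨-, h'⟩ := mem_radial hq' hp'
  have hy : (q.2.val : ℝ) - q'.2.val ≠ 0 := by
    intro h0
    have : q.2.val = q'.2.val := by exact_mod_cast sub_eq_zero.1 h0
    exact hne (Prod.ext (Fin.ext (hq.trans hq'.symm)) (Fin.ext this))
  have hx : p.1 + 1 = 0 := by
    have : (p.1 + 1) * ((q.2.val : ℝ) - q'.2.val) = 0 := by linarith
    exact (mul_eq_zero.1 this).resolve_right hy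
  refine Prod.ext ?_ ?_
  · rw [pos_none]
    linarith
  · rw [h, hx, pos_none, zero_mul]

theorem eq_pos_of_mem_radial {q : Fin a × Fin b} (hq : q.1.val = 0) {p : ℝ × ℝ}
    (hp : p ∈ curve L s(none, some q)) (h0 : 0 ≤ p.1) : p = pos L (some q) := by
  obtain ⟨h₁, h₂⟩ := mem_radial hq hp
  have h₃ : p.1 = 0 := le_antisymm h₁ h0
  rw [pos_some, hq, height_of_dvd (dvd_zero _)]
  refine Prod.ext (by simpa using h₃) ?_
  rw [h₂, h₃]
  simp

theorem vertical_inter_vertical_of_lt {r q r' q' : Fin a × Fin b} (h₁ : q.1.val = r.1.val)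
    (h₂ : q.2.val = r.2.val + 1) (h₁' : q'.1.val = r'.1.val) (h₂' : q'.2.val = r'.2.val + 1)
    {p : ℝ × ℝ} (hp : p ∈ curve L s(some r, some q)) (hp' : p ∈ curve L s(some r', some q'))
    (hlt : r.2.val < r'.2.val) : p = pos L (some q) := by
  obtain ⟨hx, -, hy⟩ := mem_vertical h₁ h₂ hp
  obtain ⟨hx', hy', -⟩ := mem_vertical h₁' h₂' hp'
  have hxx : r.1.val = r'.1.val := by exact_mod_cast hx.symm.trans hx'
  rw [← hxx] at hy'
  have := (height_strictMono (L := L) r.1.val).monotone (Nat.succ_le_of_lt hlt)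
  rw [pos_some, h₁, h₂]
  exact Prod.ext hx (le_antisymm hy (this.trans hy'))

theorem horizontal_inter_horizontal_of_lt {r q r' q' : Fin a × Fin b} (h₁ : q.2.val = r.2.val)
    (h₂ : L r.2.val ∣ r.1.val) (h₃ : q.1.val = r.1.val + L r.2.val) (h₁' : q'.2.val = r'.2.val)
    (h₂' : L r'.2.val ∣ r'.1.val) (h₃' : q'.1.val = r'.1.val + L r'.2.val)
    {p : ℝ × ℝ} (hp : p ∈ curve L s(some r, some q)) (hp' : p ∈ curve L s(some r', some q'))
    (hlt : r.1.val < r'.1.val) : p = pos L (some q) := by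
  obtain ⟨hy, -, hx⟩ := mem_horizontal h₁ h₂ h₃ hp
  obtain ⟨hy', hx', -⟩ := mem_horizontal h₁' h₂' h₃' hp'
  have hyy : r.2.val = r'.2.val := by exact_mod_cast hy.symm.trans hy'
  rw [← hyy] at h₂'
  have hle : r.1.val + L r.2.val ≤ r'.1.val := by
    have := Nat.le_of_dvd (Nat.sub_pos_of_lt hlt) (Nat.dvd_sub h₂' h₂)
    omega
  have hle' : (r.1.val : ℝ) + L r.2.val ≤ r'.1.val := by exact_mod_cast hle
  have h₄ : L q.2.val ∣ q.1.val := by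
    rw [h₁, h₃]
    exact dvd_add h₂ dvd_rfl
  rw [pos_some, height_of_dvd h₄, h₁, h₃]
  refine Prod.ext ?_ hy
  push_cast
  linarith

/-- The lower end has height in `[y, y + 1/2]` and the upper end in `[y + 1, y + 3/2]`, so the only
integer height strictly between them can be `y + 1`. The horizontal edge there starts at the last
multiple of `L (y + 1)` before the column. -/
theorem vertical_inter_horizontal {r q r' q' : Fin a × Fin b} (h₁ : q.1.val = r.1.val)
    (h₂ : q.2.val = r.2.val + 1) (h₁' : q'.2.val = r'.2.val)
    (h₂' : L r'.2.val ∣ r'.1.val) (h₃' : q'.1.val = r'.1.val + L r'.2.val)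
    {p : ℝ × ℝ} (hp : p ∈ curve L s(some r, some q)) (hp' : p ∈ curve L s(some r', some q'))
    (hr : p ≠ pos L (some r)) (hq : p ≠ pos L (some q)) :
    r'.2.val = r.2.val + 1 ∧ r'.1.val = r.1.val / L (r.2.val + 1) * L (r.2.val + 1) ∧
      p = ((r.1.val : ℝ), ((r.2.val + 1 : ℕ) : ℝ)) := by
  obtain ⟨hx, hy₁, hy₂⟩ := mem_vertical h₁ h₂ hp
  obtain ⟨hy', hx₁, hx₂⟩ := mem_horizontal h₁' h₂' h₃' hp'
  have hy₃ : height L r.1.val r.2.val < r'.2.val := by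
    rw [← hy']
    exact lt_of_le_of_ne hy₁ fun h => hr (by rw [pos_some]; exact Prod.ext hx h.symm)
  have hy₄ : (r'.2.val : ℝ) < height L r.1.val (r.2.val + 1) := by
    rw [← hy']
    exact lt_of_le_of_ne hy₂ fun h => hq (by rw [pos_some, h₁, h₂]; exact Prod.ext hx h)
  have hge : r.2.val < r'.2.val := by
    exact_mod_cast (le_height (L := L) r.1.val r.2.val).trans_lt hy₃
  have hle : r'.2.val < r.2.val + 2 := by
    have h := hy₄.trans_le (height_le r.1.val (r.2.val + 1))
    have : (r'.2.val : ℝ) < ((r.2.val + 2 : ℕ) : ℝ) := by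
      push_cast at h ⊢
      linarith
    exact_mod_cast this
  have hyy : r'.2.val = r.2.val + 1 := by omega
  refine ⟨hyy, ?_, Prod.ext hx (by rw [hy', hyy])⟩
  rw [hyy] at hy₄ h₂' hx₂
  have hnd : ¬ L (r.2.val + 1) ∣ r.1.val := fun h => by
    rw [height_of_dvd h] at hy₄
    exact lt_irrefl _ hy₄
  rw [hx] at hx₁ hx₂
  have hx₁ : r'.1.val ≤ r.1.val := by exact_mod_cast hx₁
  have hx₂ : r.1.val ≤ r'.1.val + L (r.2.val + 1) := by exact_mod_cast hx₂
  have hx₃ : r.1.val ≠ r'.1.val + L (r.2.val + 1) := fun h =>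
    hnd (h ▸ dvd_add h₂' dvd_rfl)
  obtain ⟨i, hi⟩ := h₂'
  rw [hi] at hx₁ hx₂ hx₃ ⊢
  generalize L (r.2.val + 1) = l at *
  rw [mul_comm]
  congr 1
  symm
  refine Nat.div_eq_of_lt_le (by rwa [mul_comm]) ?_
  rw [Nat.succ_mul, mul_comm]
  omega

/-- Radial edges meet each other only at the apex and all other edges only at an end, since the rest
lies in `x ≥ 0`. Two edges of the same direction overlap at most in a common end. -/
theorem crossing_cases {e f : Sym2 (Option (Fin a × Fin b))} (he : e ∈ (skipGrid L a b).edgeSet)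
    (hf : f ∈ (skipGrid L a b).edgeSet) (hne : e ≠ f) {p : ℝ × ℝ} (hpe : p ∈ curve L e)
    (hpf : p ∈ curve L f) (hend : ∀ v, v ∈ e ∨ v ∈ f → p ≠ pos L v) :
    IsVertical e ∧ IsHorizontal L f ∨ IsHorizontal L e ∧ IsVertical f := by
  have hx : ∀ x : ℕ, (0 : ℝ) ≤ x := fun x => Nat.cast_nonneg x
  have hrad : ∀ {e f : Sym2 (Option (Fin a × Fin b))}, f ∈ (skipGrid L a b).edgeSet → e ≠ f →
      p ∈ curve L e → p ∈ curve L f → (∀ v, v ∈ e ∨ v ∈ f → p ≠ pos L v) → ¬ IsRadial e := by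
    rintro e f hf hne hpe hpf hend ⟨q, rfl, hq⟩
    have hlt : p.1 < 0 := by
      by_contra hcon
      exact hend (some q) (Or.inl (by simp)) (eq_pos_of_mem_radial hq hpe (not_lt.1 hcon))
    rcases edge_cases hf with ⟨q', rfl, hq'⟩ | ⟨r, q', rfl, h₁, h₂⟩ | ⟨r, q', rfl, h₁, h₂, h₃⟩
    · refine hend none (Or.inl (by simp)) (radial_inter_radial hq hq' ?_ hpe hpf)
      rintro rfl
      exact hne rfl
    · have := (mem_vertical h₁ h₂ hpf).1
      linarith [hx r.1.val]
    · have := (mem_horizontal h₁ h₂ h₃ hpf).2.1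
      linarith [hx r.1.val]
  have hre := hrad hf hne hpe hpf hend
  have hrf := hrad he hne.symm hpf hpe fun v hv => hend v hv.symm
  rcases edge_cases he with h | hve | hhe
  · exact absurd h hre
  · rcases edge_cases hf with h | hvf | hhf
    · exact absurd h hrf
    · exfalso
      obtain ⟨r, q, rfl, h₁, h₂⟩ := hve
      obtain ⟨r', q', rfl, h₁', h₂'⟩ := hvf
      rcases lt_trichotomy r.2.val r'.2.val with hlt | heq | hlt
      · exact hend (some q) (Or.inl (by simp))
          (vertical_inter_vertical_of_lt h₁ h₂ h₁' h₂' hpe hpf hlt)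
      · have hxx : r.1.val = r'.1.val := by
          exact_mod_cast (mem_vertical h₁ h₂ hpe).1.symm.trans (mem_vertical h₁' h₂' hpf).1
        have hr : r = r' := Prod.ext (Fin.ext hxx) (Fin.ext heq)
        have hq : q = q' := Prod.ext (Fin.ext (by omega)) (Fin.ext (by omega))
        exact hne (by rw [hr, hq])
      · exact hend (some q') (Or.inr (by simp))
          (vertical_inter_vertical_of_lt h₁' h₂' h₁ h₂ hpf hpe hlt)
    · exact Or.inl ⟨hve, hhf⟩
  · rcases edge_cases hf with h | hvf | hhf
    · exact absurd h hrf
    · exact Or.inr ⟨hhe, hvf⟩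
    · exfalso
      obtain ⟨r, q, rfl, h₁, h₂, h₃⟩ := hhe
      obtain ⟨r', q', rfl, h₁', h₂', h₃'⟩ := hhf
      rcases lt_trichotomy r.1.val r'.1.val with hlt | heq | hlt
      · exact hend (some q) (Or.inl (by simp))
          (horizontal_inter_horizontal_of_lt h₁ h₂ h₃ h₁' h₂' h₃' hpe hpf hlt)
      · have hyy : r.2.val = r'.2.val := by
          exact_mod_cast (mem_horizontal h₁ h₂ h₃ hpe).1.symm.trans
            (mem_horizontal h₁' h₂' h₃' hpf).1
        have hr : r = r' := Prod.ext (Fin.ext heq) (Fin.ext hyy)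
        subst hr
        have hq : q = q' := Prod.ext (Fin.ext (by omega)) (Fin.ext (by omega))
        exact hne (by rw [hq])
      · exact hend (some q') (Or.inr (by simp))
          (horizontal_inter_horizontal_of_lt h₁' h₂' h₃' h₁ h₂ h₃ hpf hpe hlt)

theorem crossing_unique {e f f' : Sym2 (Option (Fin a × Fin b))} (he : IsVertical e)
    (hf : IsHorizontal L f) (hf' : IsHorizontal L f') {p p' : ℝ × ℝ} (hpe : p ∈ curve L e)
    (hpf : p ∈ curve L f) (hpe' : p' ∈ curve L e) (hpf' : p' ∈ curve L f')
    (hp : ∀ v ∈ e, p ≠ pos L v) (hp' : ∀ v ∈ e, p' ≠ pos L v) : p = p' ∧ f = f' := by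
  obtain ⟨r, q, rfl, h₁, h₂⟩ := he
  obtain ⟨s, t, rfl, h₃, h₄, h₅⟩ := hf
  obtain ⟨s', t', rfl, h₃', h₄', h₅'⟩ := hf'
  obtain ⟨i₁, i₂, i₃⟩ := vertical_inter_horizontal h₁ h₂ h₃ h₄ h₅ hpe hpf
    (hp _ (by simp)) (hp _ (by simp))
  obtain ⟨j₁, j₂, j₃⟩ := vertical_inter_horizontal h₁ h₂ h₃' h₄' h₅' hpe' hpf'
    (hp' _ (by simp)) (hp' _ (by simp))
  have hs : s = s' := Prod.ext (Fin.ext (i₂.trans j₂.symm)) (Fin.ext (i₁.trans j₁.symm))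
  subst hs
  have ht : t = t' := Prod.ext (Fin.ext (h₅.trans h₅'.symm)) (Fin.ext (h₃.trans h₃'.symm))
  exact ⟨i₃.trans j₃.symm, by rw [ht]⟩

theorem not_isVertical_of_isHorizontal (hL : ∀ y, 0 < L y) {e : Sym2 (Option (Fin a × Fin b))}
    (h : IsHorizontal L e) : ¬ IsVertical e := by
  obtain ⟨r, q, rfl, h₁, -, h₃⟩ := h
  rintro ⟨r', q', h, h₄, h₅⟩
  have := hL r.2.val
  rw [Sym2.eq_iff] at h
  rcases h with ⟨h, h'⟩ | ⟨h, h'⟩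
  · rw [Option.some.inj h, Option.some.inj h'] at h₁
    omega
  · rw [Option.some.inj h, Option.some.inj h'] at h₁
    omega

/-- Each crossing is charged to its vertical edge, which determines both the point and the
horizontal edge. -/
theorem isGapPlanar_one (hL : ∀ y, 0 < L y) (a b : ℕ) : IsGapPlanar 1 (skipGrid L a b) := by
  have hcross : ∀ c ∈ (drawing L a b).crossings, ∃ e f : (skipGrid L a b).edgeSet,
      c.2 = s(e, f) ∧ IsVertical e.1 ∧ IsHorizontal L f.1 ∧ c.1 ∈ curve L e.1 ∧
        c.1 ∈ curve L f.1 ∧ ∀ v ∈ e.1, c.1 ≠ pos L v := by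
    rintro c ⟨e, f, hne, hc, ⟨hpe, hpf⟩, hend⟩
    rcases crossing_cases e.2 f.2 (fun h => hne (Subtype.ext h)) hpe hpf hend with h | h
    · exact ⟨e, f, hc, h.1, h.2, hpe, hpf, fun v hv => hend v (Or.inl hv)⟩
    · exact ⟨f, e, hc.trans Sym2.eq_swap, h.2, h.1, hpf, hpe, fun v hv => hend v (Or.inr hv)⟩
  refine ⟨drawing L a b, PlaneDrawing.isGap_one _ (fun e => IsVertical e.1) ?_ ?_⟩
  · intro c hc
    obtain ⟨e, f, h, hv, -⟩ := hcross c hc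
    exact ⟨e, h ▸ Sym2.mem_mk_left e f, hv⟩
  · rintro ⟨p, x⟩ hc ⟨p', x'⟩ hc' e hv he he'
    obtain ⟨e₁, f, rfl : x = _, -, hf, h₁, h₂, h₃⟩ := hcross _ hc
    obtain ⟨e₂, f', rfl : x' = _, -, hf', h₁', h₂', h₃'⟩ := hcross _ hc'
    have heq : ∀ {e₁ f : (skipGrid L a b).edgeSet}, IsHorizontal L f.1 → e ∈ s(e₁, f) →
        e₁ = e := by
      intro e₁ f hf he
      rcases Sym2.mem_iff.1 he with h | h
      · exact h.symm
      · exact absurd hv (h ▸ not_isVertical_of_isHorizontal hL hf)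
    obtain rfl := heq hf he
    obtain rfl := heq hf' he'
    obtain ⟨hp, hff⟩ := crossing_unique hv hf hf' h₁ h₂ h₁' h₂' h₃ h₃'
    rw [show p = p' from hp, Subtype.ext hff]

end skipGrid

/-! ### Treewidth and distances in the skip grid -/

namespace skipGrid

variable {L : ℕ → ℕ} {a b : ℕ}

/-- The vertices in row `y`. -/
def row (a : ℕ) {b : ℕ} (y : Fin b) : Set (Option (Fin a × Fin b)) :=
  {v | ∃ p : Fin a × Fin b, v = some p ∧ p.2 = y}

/-- The vertices in column `x`. -/
def column {a : ℕ} (b : ℕ) (x : Fin a) : Set (Option (Fin a × Fin b)) :=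
  {v | ∃ p : Fin a × Fin b, v = some p ∧ p.1 = x}

/-- An arbitrary superset `S` of the column is allowed so that the path can be used inside a cross.
-/
theorem reachable_in_column {S : Set (Option (Fin a × Fin b))} {x : Fin a}
    (hS : column b x ⊆ S) (d : ℕ) (y y' : Fin b) (h : y'.val = y.val + d) :
    ((skipGrid L a b).induce S).Reachable ⟨some (x, y), hS ⟨_, rfl, rfl⟩⟩
      ⟨some (x, y'), hS ⟨_, rfl, rfl⟩⟩ := by
  induction d generalizing y' with
  | zero =>
    obtain rfl : y' = y := Fin.ext h
    rfl
  | succ d ih =>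
    refine (ih ⟨y.val + d, by omega⟩ rfl).trans (SimpleGraph.Adj.reachable ?_)
    exact adj_vertical rfl h

theorem reachable_in_row {S : Set (Option (Fin a × Fin b))} {y : Fin b} (hL : L y.val = 1)
    (hS : row a y ⊆ S) (d : ℕ) (x x' : Fin a) (h : x'.val = x.val + d) :
    ((skipGrid L a b).induce S).Reachable ⟨some (x, y), hS ⟨_, rfl, rfl⟩⟩
      ⟨some (x', y), hS ⟨_, rfl, rfl⟩⟩ := by
  induction d generalizing x' with
  | zero =>
    obtain rfl : x' = x := Fin.ext h
    rfl
  | succ d ih =>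
    refine (ih ⟨x.val + d, by omega⟩ rfl).trans (SimpleGraph.Adj.reachable ?_)
    exact adj_horizontal (by simp [hL]) rfl (by simp [hL]) (by simp [hL, h, add_assoc])

theorem preconnected_cross {y : Fin b} (hL : L y.val = 1) (x : Fin a) :
    ((skipGrid L a b).induce (row a y ∪ column b x)).Preconnected := by
  have hc : some (x, y) ∈ row a y ∪ column b x := Or.inl ⟨_, rfl, rfl⟩
  have key : ∀ v : ↥(row a y ∪ column b x),
      ((skipGrid L a b).induce (row a y ∪ column b x)).Reachable ⟨some (x, y), hc⟩ v := by
    rintro ⟨_, ⟨⟨x', _⟩, rfl, rfl⟩ | ⟨⟨_, y'⟩, rfl, rfl⟩⟩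
    · rcases le_total x.val x'.val with h | h
      · exact reachable_in_row hL Set.subset_union_left _ _ _ (Nat.add_sub_of_le h).symm
      · exact (reachable_in_row hL Set.subset_union_left _ _ _ (Nat.add_sub_of_le h).symm).symm
    · rcases le_total y.val y'.val with h | h
      · exact reachable_in_column Set.subset_union_right _ _ _ (Nat.add_sub_of_le h).symm
      · exact (reachable_in_column Set.subset_union_right _ _ _ (Nat.add_sub_of_le h).symm).symm
  exact fun u v => (key u).symm.trans (key v)

/-- Rows of length `1` are complete paths; `f` selects as many of them as there are columns, and the
bound for crosses applies. -/
theorem le_treewidth_add_one (ha : 0 < a) (f : Fin a → Fin b) (hf : Function.Injective f)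
    (hL : ∀ i, L (f i).val = 1) : a ≤ treewidth (skipGrid L a b) + 1 := by
  refine le_treewidth_add_one_of_crosses ha (fun i => row a (f i)) (column b) ?_ ?_
    (fun i j => preconnected_cross (hL i) j)
    fun i j => ⟨some (j, f i), ⟨_, rfl, rfl⟩, _, rfl, rfl⟩
  · intro i j hij
    rw [Set.disjoint_left]
    rintro _ ⟨p, rfl, hp⟩ ⟨q, hq, hq'⟩
    rw [← Option.some.inj hq, hp] at hq'
    exact hij (hf hq')
  · intro i j hij
    rw [Set.disjoint_left]
    rintro _ ⟨p, rfl, hp⟩ ⟨q, hq, hq'⟩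
    rw [← Option.some.inj hq, hp] at hq'
    exact hij hq'

theorem edist_column_le (d : ℕ) (x : Fin a) (y y' : Fin b) (h : y'.val = y.val + d) :
    (skipGrid L a b).edist (some (x, y)) (some (x, y')) ≤ d := by
  induction d generalizing y' with
  | zero =>
    obtain rfl : y' = y := Fin.ext h
    simp
  | succ d ih =>
    rw [Nat.cast_succ]
    refine SimpleGraph.edist_triangle.trans
      (add_le_add (ih ⟨y.val + d, by omega⟩ rfl) (le_of_eq ?_))
    rw [SimpleGraph.edist_eq_one_iff_adj]
    exact adj_vertical rfl h

theorem edist_row_le (d : ℕ) (x x' : Fin a) (y : Fin b) (hL : 0 < L y.val) (hx : L y.val ∣ x.val)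
    (h : x'.val = x.val + d * L y.val) :
    (skipGrid L a b).edist (some (x, y)) (some (x', y)) ≤ d := by
  induction d generalizing x' with
  | zero =>
    obtain rfl : x' = x := Fin.ext (by simpa using h)
    simp
  | succ d ih =>
    rw [Nat.succ_mul] at h
    rw [Nat.cast_succ]
    refine SimpleGraph.edist_triangle.trans
      (add_le_add (ih ⟨x.val + d * L y.val, by omega⟩ rfl) (le_of_eq ?_))
    rw [SimpleGraph.edist_eq_one_iff_adj]
    refine adj_horizontal hL rfl (dvd_add hx (Dvd.intro_left _ rfl)) ?_
    rw [h, add_assoc]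

end skipGrid

/-! ### Periodic powers: small radius, large treewidth -/

/-- Row lengths that run periodically through `n ^ k, …, n, 1`. -/
def periodicPow (n k y : ℕ) : ℕ := n ^ (k - y % (k + 1))

theorem periodicPow_eq (n k i : ℕ) {j : ℕ} (hj : j ≤ k) :
    periodicPow n k ((k + 1) * i + j) = n ^ (k - j) := by
  rw [periodicPow, Nat.mul_add_mod, Nat.mod_eq_of_lt (Nat.lt_succ_of_le hj)]

/-- Reads the base-`n` expansion of `x` down the rows of period `i`; after row `j` the position is
`x` rounded down to a multiple of `n ^ (k - j)`. The apex edge and leading part cost at most `n +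
2`, each later row one vertical step and a digit of at most `n - 1`. -/
theorem edist_apex_le {n k m x i : ℕ} (hn : 0 < n) (hx : x < n ^ (k + 1) + 2)
    (j : ℕ) (hj : j ≤ k) (x' : Fin (n ^ (k + 1) + 2)) (y : Fin ((k + 1) * m))
    (hx' : x'.val = x / n ^ (k - j) * n ^ (k - j)) (hy : y.val = (k + 1) * i + j) :
    (skipGrid (periodicPow n k) (n ^ (k + 1) + 2) ((k + 1) * m)).edist none (some (x', y)) ≤
      (n + 2 + j * n : ℕ) := by
  have hpow : ∀ e, 0 < n ^ e := fun e => pow_pos hn e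
  have hLy : periodicPow n k y.val = n ^ (k - j) := by rw [hy, periodicPow_eq n k i hj]
  induction j generalizing x' y with
  | zero =>
    rw [Nat.sub_zero] at hx' hLy
    -- The leading part may exceed a digit, because there are `n ^ (k + 1) + 2` columns.
    have hd : x / n ^ k ≤ n + 1 := by
      refine Nat.lt_succ_iff.1 ((Nat.div_lt_iff_lt_mul (hpow k)).2 ?_)
      have := hpow k
      calc x < n ^ (k + 1) + 2 := hx
        _ ≤ n ^ (k + 1) + 2 * n ^ k := by omega
        _ = (n + 1 + 1) * n ^ k := by ring
    have h₁ : (skipGrid (periodicPow n k) (n ^ (k + 1) + 2) ((k + 1) * m)).edist none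
        (some (⟨0, by omega⟩, y)) = 1 := by
      rw [SimpleGraph.edist_eq_one_iff_adj]
      exact skipGrid.adj_apex rfl
    refine SimpleGraph.edist_triangle.trans ((add_le_add h₁.le
      (skipGrid.edist_row_le (x / n ^ k) ⟨0, by omega⟩ x' y (by rw [hLy]; exact hpow k)
        (dvd_zero _) (by rw [hLy, hx']; simp))).trans ?_)
    have : 1 + x / n ^ k ≤ n + 2 + 0 * n := by omega
    exact_mod_cast this
  | succ j ih =>
    obtain ⟨e, he⟩ : ∃ e, k - (j + 1) = e := ⟨_, rfl⟩
    have he' : k - j = e + 1 := by omega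
    have hlt : x / n ^ (k - j) * n ^ (k - j) ≤ x := Nat.div_mul_le_self _ _
    have hyj : (k + 1) * i + j < (k + 1) * m := by
      have := y.2
      omega
    have h₁ := ih (by omega) ⟨_, hlt.trans_lt hx⟩ ⟨_, hyj⟩ rfl rfl
      (periodicPow_eq n k i (by omega))
    have h₂ : (skipGrid (periodicPow n k) (n ^ (k + 1) + 2) ((k + 1) * m)).edist
        (some (⟨_, hlt.trans_lt hx⟩, ⟨_, hyj⟩)) (some (⟨_, hlt.trans_lt hx⟩, y)) ≤ (1 : ℕ) :=
      skipGrid.edist_column_le 1 _ _ _ hy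
    -- The next digit `x / n ^ e % n` is the number of skips needed in this row.
    have h₃ := skipGrid.edist_row_le (L := periodicPow n k) (x / n ^ e % n)
      ⟨_, hlt.trans_lt hx⟩ x' y (by rw [hLy]; exact hpow _)
      (by
        simp only [hLy, he, he', pow_succ']
        exact Dvd.intro_left _ (mul_assoc _ _ _))
      (by
        simp only [hLy, hx', he, he', pow_succ, ← Nat.div_div_eq_div_mul]
        have := Nat.div_add_mod' (x / n ^ e) n
        nth_rw 1 [← this]
        ring)
    refine SimpleGraph.edist_triangle.trans ((add_le_add
      (SimpleGraph.edist_triangle.trans (add_le_add h₁ h₂)) h₃).trans ?_)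
    have : x / n ^ e % n < n := Nat.mod_lt _ hn
    have : n + 2 + j * n + 1 + x / n ^ e % n ≤ n + 2 + (j + 1) * n := by
      rw [Nat.succ_mul]
      omega
    exact_mod_cast this

theorem radius_skipGrid_periodicPow_le {n : ℕ} (hn : 0 < n) (k m : ℕ) :
    (skipGrid (periodicPow n k) (n ^ (k + 1) + 2) ((k + 1) * m)).radius ≤
      (n + 2 + k * n + k : ℕ) := by
  refine SimpleGraph.radius_le_eccent.trans (iSup_le fun v => ?_ :
    (skipGrid (periodicPow n k) (n ^ (k + 1) + 2) ((k + 1) * m)).eccent none ≤ _)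
  rcases v with _ | ⟨x, y⟩
  · simp
  · have hmod := Nat.div_add_mod y.val (k + 1)
    have hlt : y.val % (k + 1) < k + 1 := Nat.mod_lt _ (Nat.succ_pos k)
    have hi : y.val / (k + 1) < m := Nat.div_lt_of_lt_mul y.2
    have hb : (k + 1) * (y.val / (k + 1)) + k < (k + 1) * m := by
      have := Nat.mul_le_mul_left (k + 1) (Nat.succ_le_of_lt hi)
      rw [Nat.mul_succ] at this
      omega
    -- In the last row of the period the length is `1`, so `x` is reached exactly; at most `k`
    -- vertical steps then lead back to row `y`.
    have h₁ := edist_apex_le hn x.2 k le_rfl x ⟨_, hb⟩ (by simp) rfl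
    have h₂ := skipGrid.edist_column_le (L := periodicPow n k) (k - y.val % (k + 1)) x y ⟨_, hb⟩
      (by simp only; omega)
    rw [SimpleGraph.edist_comm] at h₂
    refine SimpleGraph.edist_triangle.trans ((add_le_add h₁ h₂).trans ?_)
    have : n + 2 + k * n + (k - y.val % (k + 1)) ≤ n + 2 + k * n + k := by omega
    exact_mod_cast this

/-- Each of the `n ^ (k + 1) + 2` periods ends in one full row, matching the number of columns; the
extra `2` absorbs the loss of one in the cross bound. -/
theorem le_treewidth_skipGrid_periodicPow (n k : ℕ) :
    n ^ (k + 1) + 1 ≤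
      treewidth (skipGrid (periodicPow n k) (n ^ (k + 1) + 2) ((k + 1) * (n ^ (k + 1) + 2))) := by
  have hb : ∀ i : Fin (n ^ (k + 1) + 2), (k + 1) * i.val + k < (k + 1) * (n ^ (k + 1) + 2) := by
    intro i
    have := Nat.mul_le_mul_left (k + 1) (Nat.succ_le_of_lt i.2)
    rw [Nat.mul_succ] at this
    omega
  have := skipGrid.le_treewidth_add_one (L := periodicPow n k) (Nat.succ_pos _)
    (fun i => ⟨_, hb i⟩) (fun i j h => by
      have h : (k + 1) * i.val + k = (k + 1) * j.val + k := congrArg Fin.val h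
      exact Fin.ext (Nat.eq_of_mul_eq_mul_left (Nat.succ_pos k) (Nat.add_right_cancel h)))
    (fun i => by simp only [periodicPow_eq n k i.val le_rfl, Nat.sub_self, pow_zero])
  exact Nat.le_of_succ_le_succ this

/-! ### The four consequences -/

theorem exists_isGapPlanar_one_pow_le_treewidth (n k : ℕ) (hn : 1 ≤ n) (hk : 1 ≤ k) :
    ∃ (V : Type) (_ : Finite V) (G : SimpleGraph V), IsGapPlanar 1 G ∧
      n ^ (k + 1) + 1 ≤ treewidth G ∧
      G.radius ≤ (((2 * k + 1) * n + ⌈(k : ℝ) / 2⌉₊ + 1 : ℕ) : ℕ∞) := by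
  refine ⟨_, inferInstance, _, skipGrid.isGapPlanar_one (fun y => pow_pos hn _) _ _,
    le_treewidth_skipGrid_periodicPow n k, (radius_skipGrid_periodicPow_le hn k _).trans ?_⟩
  -- The actual radius bound is `n + 2 + k * n + k`; the stated one follows from `k ≤ k * n` and `1
  -- ≤ ⌈k / 2⌉`.
  have h₁ : 1 ≤ ⌈(k : ℝ) / 2⌉₊ := Nat.one_le_ceil_iff.2 (by positivity)
  have h₂ : k ≤ k * n := Nat.le_mul_of_pos_right k hn
  have : n + 2 + k * n + k ≤ (2 * k + 1) * n + ⌈(k : ℝ) / 2⌉₊ + 1 := by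
    have : (2 * k + 1) * n = k * n + k * n + n := by ring
    omega
  exact_mod_cast this

/-- There are `1`-gap planar graphs of radius linear in `k` and treewidth exponential in `k`. -/
theorem exists_isGapPlanar_one_two_pow_le_treewidth (k : ℕ) (hk : 1 ≤ k) :
    ∃ (V : Type) (_ : Finite V) (G : SimpleGraph V), IsGapPlanar 1 G ∧
      2 ^ k ≤ treewidth G ∧ G.radius ≤ ((8 * k : ℕ) : ℕ∞) := by
  obtain ⟨V, hV, G, hG, htw, hr⟩ := exists_isGapPlanar_one_pow_le_treewidth 2 k one_le_two hk
  refine ⟨V, hV, G, hG, ?_, hr.trans ?_⟩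
  · have := Nat.pow_le_pow_right two_pos (Nat.le_succ k)
    rw [Nat.succ_eq_add_one] at this
    omega
  · have h : ⌈(k : ℝ) / 2⌉₊ ≤ k := by
      rw [Nat.ceil_le]
      have := Nat.cast_nonneg (α := ℝ) k
      linarith
    -- The left side is at most `5 * k + 3`, and `k ≥ 1`.
    have : (2 * k + 1) * 2 + ⌈(k : ℝ) / 2⌉₊ + 1 ≤ 8 * k := by omega
    exact_mod_cast this

/-- Both `k / 2 ^ k` and `1 / 2 ^ k` tend to `0`. -/
theorem exists_mul_add_lt_two_pow (a b : ℝ) : ∃ k : ℕ, 1 ≤ k ∧ a * k + b < 2 ^ k := by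
  have h := (tendsto_pow_const_div_const_pow_of_one_lt 1 (one_lt_two (α := ℝ))).const_mul a
  have h' := (tendsto_pow_const_div_const_pow_of_one_lt 0 (one_lt_two (α := ℝ))).const_mul b
  have h'' := h.add h'
  rw [mul_zero, mul_zero, add_zero] at h''
  obtain ⟨k, hk, hk'⟩ := ((h''.eventually_lt_const one_pos).and
    (Filter.eventually_ge_atTop 1)).exists
  refine ⟨k, hk', ?_⟩
  have hp : (0 : ℝ) < 2 ^ k := by positivity
  rw [pow_one, pow_zero, ← mul_div_assoc, ← mul_div_assoc, ← add_div, div_lt_one hp, mul_one] at hk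
  exact hk

theorem SimpleGraph.exists_forall_edist_le_of_radius_le {V : Type*} [Finite V]
    {G : SimpleGraph V} {r : ℕ} (h : G.radius ≤ r) : ∃ c, ∀ v, G.edist c v ≤ r := by
  rcases isEmpty_or_nonempty V with hV | hV
  · rw [SimpleGraph.radius_eq_top_of_isEmpty] at h
    exact absurd h (by simp)
  · obtain ⟨c, hc⟩ := G.exists_eccent_eq_radius
    exact ⟨c, fun v => SimpleGraph.edist_le_eccent.trans (hc.le.trans h)⟩

/-- At radius `8 * k` the ball around a centre is the whole graph, so a linear bound in `8 * k`
would dominate `2 ^ k`. -/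
theorem not_hasLinearLocalTreewidth_isGapPlanar_one :
    ¬ HasLinearLocalTreewidth (fun _ G => IsGapPlanar 1 G) := by
  rintro ⟨a, b, h⟩
  obtain ⟨k, hk, hlt⟩ := exists_mul_add_lt_two_pow (a * 8) b
  obtain ⟨V, _, G, hG, htw, hr⟩ := exists_isGapPlanar_one_two_pow_le_treewidth k hk
  obtain ⟨c, hc⟩ := SimpleGraph.exists_forall_edist_le_of_radius_le hr
  have h₁ := h V G hG c (8 * k)
  have h₂ := htw.trans (treewidth_le_treewidth_induce_of_forall_mem G
    (s := {w | G.edist c w ≤ ((8 * k : ℕ) : ℕ∞)}) hc)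
  have h₃ : (2 : ℝ) ^ k ≤ treewidth (G.induce {w | G.edist c w ≤ ((8 * k : ℕ) : ℕ∞)}) := by
    exact_mod_cast h₂
  push_cast at h₁ h₃
  linarith

theorem not_hasBoundedRowTreewidth_isGapPlanar_one :
    ¬ HasBoundedRowTreewidth (fun _ G => IsGapPlanar 1 G) := by
  rintro ⟨t, h⟩
  -- The constants come from expanding `(t + 1) * (2 * (8 * k) + 1)`, the treewidth bound at radius
  -- `8 * k`.
  obtain ⟨k, hk, hlt⟩ := exists_mul_add_lt_two_pow ((t + 1) * 16) (t + 1)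
  obtain ⟨V, _, G, hG, htw, hr⟩ := exists_isGapPlanar_one_two_pow_le_treewidth k hk
  obtain ⟨c, hc⟩ := SimpleGraph.exists_forall_edist_le_of_radius_le hr
  have h₁ := (htw.trans (treewidth_le_of_edist_le G c (8 * k) hc)).trans
    (Nat.mul_le_mul_right _ (Nat.succ_le_succ (h V G hG)))
  have h₂ : (2 : ℝ) ^ k ≤ (t + 1) * (2 * (8 * k) + 1) := by exact_mod_cast h₁
  linarith

theorem infinite_setOf_exists_isGapPlanar_one_two_rpow_le_treewidth :
    ∃ c : ℝ, 0 < c ∧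
      {r : ℕ | 1 ≤ r ∧
        ∃ (V : Type) (_ : Finite V) (G : SimpleGraph V), IsGapPlanar 1 G ∧
          G.radius ≤ (r : ℕ∞) ∧ (2 : ℝ) ^ (c * (r : ℝ)) ≤ (treewidth G : ℝ)}.Infinite := by
  -- The radii are the positive multiples of `8`: radius `8 * (k + 1)` comes with treewidth at least
  -- `2 ^ (k + 1)`.
  refine ⟨1 / 8, by norm_num, ?_⟩
  refine Set.infinite_of_injective_forall_mem (f := fun k : ℕ => 8 * (k + 1))
    (fun i j h => by simp only at h; omega) fun k => ?_
  obtain ⟨V, hV, G, hG, htw, hr⟩ :=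
    exists_isGapPlanar_one_two_pow_le_treewidth (k + 1) (Nat.le_add_left 1 k)
  refine ⟨by omega, V, hV, G, hG, hr, ?_⟩
  have h : (1 / 8 : ℝ) * ((8 * (k + 1) : ℕ) : ℝ) = ((k + 1 : ℕ) : ℝ) := by
    push_cast
    ring
  rw [h, Real.rpow_natCast]
  exact_mod_cast htw

theorem mainTheorem7 :
    (∀ n k : ℕ, 1 ≤ n → 1 ≤ k →
      ∃ (V : Type) (_ : Finite V) (G : SimpleGraph V), IsGapPlanar 1 G ∧
        n ^ (k + 1) + 1 ≤ treewidth G ∧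
        G.radius ≤ (((2 * k + 1) * n + ⌈(k : ℝ) / 2⌉₊ + 1 : ℕ) : ℕ∞)) ∧
    (∃ c : ℝ, 0 < c ∧
      {r : ℕ | 1 ≤ r ∧
        ∃ (V : Type) (_ : Finite V) (G : SimpleGraph V), IsGapPlanar 1 G ∧
          G.radius ≤ (r : ℕ∞) ∧ (2 : ℝ) ^ (c * (r : ℝ)) ≤ (treewidth G : ℝ)}.Infinite) ∧
    ¬ HasLinearLocalTreewidth (fun _ G => IsGapPlanar 1 G) ∧
    ¬ HasBoundedRowTreewidth (fun _ G => IsGapPlanar 1 G) := by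
  exact ⟨exists_isGapPlanar_one_pow_le_treewidth,
    infinite_setOf_exists_isGapPlanar_one_two_rpow_le_treewidth,
    not_hasLinearLocalTreewidth_isGapPlanar_one, not_hasBoundedRowTreewidth_isGapPlanar_one⟩
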